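/- Let $n\in\mathbb N$, let $1\le k\le\infty$, and let $H:\mathbb R^{2n}\to\mathbb R$ be of class $C^{k+1}$. Write $z=(q,p)$ for the points of $\mathbb R^{2n}$, let $J=\begin{pmatrix}0&-I_n\\ I_n&0\end{pmatrix}$, and let $\phi_h$ be the exact time-$h$ flow map of the Hamiltonian system $\dot z=J^{-1}\nabla H(z)$ (defined at those $z$ from which the solution exists up to time $h$). On $\mathbb R^{2n}\times\mathbb R^{2n}$, with points $(z,\bar z)=(q,p,\bar q,\bar p)$, consider the one-form $$\alpha=\sum_{j=1}^n\Big((\bar q^j-q^j)\,d\Big(\frac{\bar p^j+p^j}{2}\Big)-(\bar p^j-p^j)\,d\Big(\frac{\bar q^j+q^j}{2}\Big)\Big),$$ which satisfies $d\alpha=\sum_j(d\bar q^j\wedge d\bar p^j-dq^j\wedge dp^j)$. Then for every compact set $K\subset\mathbb R^{2n}$ there is $h_0>0$ such that for every step size $0<h<h_0$ and every $z_0\in K$ there are open sets $U\ni z_0$ and $V$ in $\mathbb R^{2n}$ with the following properties. 1. $\phi_h$ is well defined and $C^k$ on $U$, and the midpoint map $z\mapsto\frac{\phi_h(z)+z}{2}$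 is a $C^k$ diffeomorphism from $U$ onto $V$; that is, the midpoint coordinates $\big(\frac{\bar q+q}{2},\frac{\bar p+p}{2}\big)$ are a chart, with image $V$, of the graph $\Gamma_U=\{(z,\phi_h(z)) : z\in U\}$. 2. There is a $C^{k+1}$ function $S:V\to\mathbb R$ that is a generating function of $\phi_h$ in midpoint coordinates over $U$, i.e. $d\big(S\big(\frac{\bar z+z}{2}\big)\big)=\alpha$ on $\Gamma_U$. 3. A differentiable function $S:V\to\mathbb R$ is such a generating function if and only if, for all $(q,p)\in U$ and $(\bar q,\bar p)=\phi_h(q,p)$, $$\bar q=q+\nabla_pS\Big(\frac{\bar q+q}{2},\frac{\bar p+p}{2}\Big),\qquad \bar p=p-\nabla_qS\Big(\frac{\bar q+q}{2},\frac{\bar p+p}{2}\Big).\tag{$*$}$$ 4. Call a differentiable function $\overline H:V\to\mathbb R$ an inverse modified Hamiltonian over $U$ (for the implicit midpoint rule with step size $h$) if $\bar z=z+h\,J^{-1}\nabla\overline H\big(\frac{\bar z+z}{2}\big)$ for all $z\in U$, $\bar z=\phi_h(z)$. A differentiable function $\overline H:V\to\mathbb R$ is an inverse modified Hamiltonian over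 $U$ if and only if $h\overline H$ satisfies the equations $(*)$ of the generating functions (with $S$ replaced by $h\overline H$). In that case, for all $z,\bar z$ with $\frac{\bar z+z}{2}\in V$, the pair $(z,\bar z)$ satisfies $\bar z=z+h\,J^{-1}\nabla\overline H\big(\frac{\bar z+z}{2}\big)$ if and only if $z\in U$ and $\bar z=\phi_h(z)$; so the implicit midpoint rule applied to $J^{-1}\nabla\overline H$ reproduces the exact flow. 5. An inverse modified Hamiltonian $\overline H:V\to\mathbb R$ over $U$ of class $C^{k+1}$ exists. -/

import Mathlib

open Set Gradient

/-- The phase space `ℝ^{2n}` with points `z = (q, p)`: the coordinates `z (Sum.inl j)` are the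
positions `q^j`, and the coordinates `z (Sum.inr j)` are the momenta `p^j`. -/
abbrev PhaseSpace (n : ℕ) : Type := EuclideanSpace ℝ (Fin n ⊕ Fin n)

/-- The Hamiltonian vector field `J⁻¹ ∇H`, where `J = [[0, -I], [I, 0]]`. -/
noncomputable def hamVF {n : ℕ} (H : PhaseSpace n → ℝ) (z : PhaseSpace n) : PhaseSpace n :=
  WithLp.toLp 2 ((Matrix.J (Fin n) ℝ)⁻¹.mulVec (WithLp.ofLp (∇ H z)))

/-- `FlowsTo f h z z'`: some solution of `ẏ = f(y)` on `[0, h]` starts at `z` and is at `z'` at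
time `h`. -/
def FlowsTo {n : ℕ} (f : PhaseSpace n → PhaseSpace n) (h : ℝ) (z z' : PhaseSpace n) : Prop :=
  ∃ γ : ℝ → PhaseSpace n, IsIntegralCurveOn γ (fun _ => f) (Icc 0 h) ∧ γ 0 = z ∧ γ h = z'

open Classical in
/-- The exact time-`h` flow map `φ_h` of `ẏ = f(y)`. At a point from which no solution exists up
to time `h` its value is meaningless (it is set to the point itself). -/
noncomputable def flowMap {n : ℕ} (f : PhaseSpace n → PhaseSpace n) (h : ℝ)
    (z : PhaseSpace n) : PhaseSpace n :=
  if hz : ∃ z', FlowsTo f h z z' then hz.choose else z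

/-- On `U` the flow map is a genuine one: a solution on `[0, h]` exists from each point of `U`, and
its end point is uniquely determined. -/
def FlowDefinedOn {n : ℕ} (f : PhaseSpace n → PhaseSpace n) (h : ℝ)
    (U : Set (PhaseSpace n)) : Prop :=
  ∀ z ∈ U, ∀ z', FlowsTo f h z z' ↔ z' = flowMap f h z

/-- The midpoint coordinates `((q̄ + q)/2, (p̄ + p)/2)` of the pair `(z, z') = ((q, p), (q̄, p̄))`. -/
noncomputable def midpt {n : ℕ} (z z' : PhaseSpace n) : PhaseSpace n := (1 / 2 : ℝ) • (z' + z)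

/-- `z'` is obtained from `z` by one step of size `h` of the implicit midpoint rule applied to
`ẏ = f(y)`. -/
def IsMidpointStep {n : ℕ} (f : PhaseSpace n → PhaseSpace n) (h : ℝ) (z z' : PhaseSpace n) : Prop :=
  z' = z + h • f (midpt z z')

/-- The differential of the midpoint coordinate with index `i`, as a linear form on `ℝ^{2n} × ℝ^{2n}`. -/
noncomputable def dMid {n : ℕ} (i : Fin n ⊕ Fin n) :
    PhaseSpace n × PhaseSpace n →L[ℝ] ℝ :=
  (1 / 2 : ℝ) •
    ((EuclideanSpace.proj i : PhaseSpace n →L[ℝ] ℝ).comp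
        (ContinuousLinearMap.snd ℝ (PhaseSpace n) (PhaseSpace n)) +
      (EuclideanSpace.proj i : PhaseSpace n →L[ℝ] ℝ).comp
        (ContinuousLinearMap.fst ℝ (PhaseSpace n) (PhaseSpace n)))

/-- The one-form
`α = ∑ j, ((q̄^j - q^j) d((p̄^j + p^j)/2) - (p̄^j - p^j) d((q̄^j + q^j)/2))`
on `ℝ^{2n} × ℝ^{2n}` with points `(z, z') = ((q, p), (q̄, p̄))`; its exterior derivative is
`∑ j, (dq̄^j ∧ dp̄^j - dq^j ∧ dp^j)`. -/
noncomputable def alphaForm {n : ℕ} (x : PhaseSpace n × PhaseSpace n) :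
    PhaseSpace n × PhaseSpace n →L[ℝ] ℝ :=
  ∑ j : Fin n,
    ((x.2 (Sum.inl j) - x.1 (Sum.inl j)) • dMid (Sum.inr j) -
      (x.2 (Sum.inr j) - x.1 (Sum.inr j)) • dMid (Sum.inl j))

/-- The map `φ` is `C^k` on `U`, and the midpoint coordinates are a `C^k` chart, with image `V`, of
the piece `{(z, φ z) | z ∈ U}` of its graph (which is parametrised by `z ∈ U`). -/
structure IsMidpointChart {n : ℕ} (k : ℕ∞) (φ : PhaseSpace n → PhaseSpace n)
    (U V : Set (PhaseSpace n)) : Prop where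
  isOpen_source : IsOpen U
  isOpen_target : IsOpen V
  contDiffOn_map : ContDiffOn ℝ k φ U
  bijOn : BijOn (fun z => midpt z (φ z)) U V
  contDiffOn_symm : ∃ ψ : PhaseSpace n → PhaseSpace n,
    InvOn ψ (fun z => midpt z (φ z)) U V ∧ ContDiffOn ℝ k ψ V

/-- `S`, a function of the midpoint coordinates, is a generating function of `φ` over `U`: on the
graph of `φ`, parametrised by `z ↦ (z, φ z)` with `z ∈ U`, one has `dS = α`, i.e. the differential
of `z ↦ S ((φ z + z)/2)` is the pullback of `α` along `z ↦ (z, φ z)`. -/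
def IsMidpointGeneratingFunction {n : ℕ} (φ : PhaseSpace n → PhaseSpace n)
    (U : Set (PhaseSpace n)) (S : PhaseSpace n → ℝ) : Prop :=
  ∀ z ∈ U, HasFDerivAt (fun w => S (midpt w (φ w)))
    ((alphaForm (z, φ z)).comp ((ContinuousLinearMap.id ℝ (PhaseSpace n)).prod (fderiv ℝ φ z))) z

/-- The partial differential equations of a generating function in midpoint coordinates: with
`(q̄, p̄) = φ (q, p)`,
`q̄ = q + ∇_p S ((q̄ + q)/2, (p̄ + p)/2)` and `p̄ = p - ∇_q S ((q̄ + q)/2, (p̄ + p)/2)`. -/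
def SatisfiesMidpointPDE {n : ℕ} (φ : PhaseSpace n → PhaseSpace n)
    (U : Set (PhaseSpace n)) (S : PhaseSpace n → ℝ) : Prop :=
  ∀ z ∈ U, ∀ j : Fin n,
    φ z (Sum.inl j) = z (Sum.inl j) + (∇ S (midpt z (φ z))) (Sum.inr j) ∧
    φ z (Sum.inr j) = z (Sum.inr j) - (∇ S (midpt z (φ z))) (Sum.inl j)

/-- `Hbar` is an inverse modified Hamiltonian over `U` for the implicit midpoint rule with step
size `h`: one step of the rule applied to `J⁻¹ ∇Hbar` yields `φ z` from each `z ∈ U`. -/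
def IsInverseModifiedHamiltonian {n : ℕ} (φ : PhaseSpace n → PhaseSpace n) (h : ℝ)
    (U : Set (PhaseSpace n)) (Hbar : PhaseSpace n → ℝ) : Prop :=
  ∀ z ∈ U, IsMidpointStep (hamVF Hbar) h z (φ z)

/-! Write ω for the symplectic form, m(z) = (φ_h(z) + z)/2 for the midpoint map and D for
derivatives. Three facts about ω carry the proof. The field J⁻¹∇H is characterised by ω(J⁻¹∇H, ·) =
dH (`symplecticForm_hamVF`). The form α at (z, z') is ω(z' - z, ·) applied to the midpoint of the
tangent vector (`alphaForm_apply`). The flow preserves ω (`bilin_fderiv_integral_solution`).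

On the graph, dS = α therefore reads dS ∘ Dm = ω(φ_h(z) - z, ·) ∘ Dm. In a chart Dm is invertible
and cancels, leaving φ_h(z) - z = J⁻¹∇S(m(z)), which is (*). The midpoint rule is the same equation
with S = h H̄, so H̄ = S/h.

To find S, view ω(φ_h(z) - z, ·) as a one-form in the midpoint variable. It is closed because φ_h is
symplectic, hence exact on a convex V by the Poincaré lemma (`exists_satisfiesMidpointPDE`).

The chart comes from the inverse function theorem: Dm = (Dφ_h + I)/2 is the identity at h = 0, so it
stays invertible near (0, z₀), and compactness of K makes h₀ uniform. This needs Φ(h, z) = φ_h(z) to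
be C^k jointly in h and z. That follows from a second inverse function theorem, applied on the
Banach space C([0,1], E) to the integral equation y = z + h ∫ f(y), with time rescaled to a fixed
interval. -/

/-! ### Postcomposition with a smooth map, as an operator on continuous paths -/

section Superposition

open unitInterval Filter Topology

universe u

variable {E F G : Type u} [NormedAddCommGroup E] [NormedSpace ℝ E] [NormedAddCommGroup F]
  [NormedSpace ℝ F] [NormedAddCommGroup G] [NormedSpace ℝ G]

/-- Pointwise application of a bilinear map to a pair of continuous paths. -/
noncomputable def pathBilin (B : G →L[ℝ] E →L[ℝ] F) : C(I, G) →L[ℝ] C(I, E) →L[ℝ] C(I, F) :=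
  LinearMap.mkContinuous₂
    (LinearMap.mk₂ ℝ (fun (A : C(I, G)) (v : C(I, E)) =>
        (⟨fun t => B (A t) (v t), by fun_prop⟩ : C(I, F)))
      (fun _ _ _ => by ext; simp) (fun _ _ _ => by ext; simp)
      (fun _ _ _ => by ext; simp) (fun _ _ _ => by ext; simp))
    ‖B‖ (fun A v => by
      refine (ContinuousMap.norm_le _ (by positivity)).2 fun t => ?_
      refine (B.le_opNorm₂ (A t) (v t)).trans ?_
      gcongr
      exacts [A.norm_coe_le_norm t, v.norm_coe_le_norm t])

theorem norm_pathBilin_apply_apply_le (B : G →L[ℝ] E →L[ℝ] F) (A : C(I, G)) (v : C(I, E)) :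
    ‖pathBilin B A v‖ ≤ ‖B‖ * ‖A‖ * ‖v‖ := by
  refine (ContinuousMap.norm_le _ (by positivity)).2 fun t => ?_
  refine (B.le_opNorm₂ (A t) (v t)).trans ?_
  gcongr
  exacts [A.norm_coe_le_norm t, v.norm_coe_le_norm t]

theorem contDiff_pathBilin (B : G →L[ℝ] E →L[ℝ] F) {m : WithTop ℕ∞} :
    ContDiff ℝ m fun A : C(I, G) => pathBilin B A :=
  IsBoundedLinearMap.contDiff
    { map_add := (pathBilin B).map_add
      map_smul := (pathBilin B).map_smul
      bound := ⟨‖B‖ + 1, by positivity, fun A =>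
        ContinuousLinearMap.opNorm_le_bound _ (by positivity) fun v =>
          (norm_pathBilin_apply_apply_le B A v).trans (by gcongr; linarith)⟩ }

/-- The mean value inequality on the ball of radius δ about `y t` bounds the remainder at each time
t. One δ serves all t because postcomposition with `g` is continuous for the sup norm. -/
theorem hasFDerivAt_comp_path (B : G →L[ℝ] E →L[ℝ] F) (f : C(E, F)) (g : C(E, G))
    (hf : ∀ x, HasFDerivAt f (B (g x)) x) (y : C(I, E)) :
    HasFDerivAt (fun y : C(I, E) => f.comp y) (pathBilin B (g.comp y)) y := by
  rw [hasFDerivAt_iff_isLittleO, Asymptotics.isLittleO_iff]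
  intro ε hε
  have hcont : Continuous fun y : C(I, E) => g.comp y := g.continuous_postcomp
  have hB : 0 < ‖B‖ + 1 := by positivity
  obtain ⟨δ, hδ, h⟩ := Metric.continuousAt_iff.1 (hcont.continuousAt (x := y)) (ε / (‖B‖ + 1))
    (by positivity)
  filter_upwards [Metric.ball_mem_nhds y hδ] with w hw
  refine (ContinuousMap.norm_le _ (by positivity)).2 fun t => ?_
  have key := (convex_ball (y t) δ).norm_image_sub_le_of_norm_hasFDerivWithin_le' (𝕜 := ℝ)
    (f := f) (f' := fun x => B (g x)) (φ := B (g (y t))) (C := ε) (x := y t) (y := w t)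
    (fun x _ => (hf x).hasFDerivWithinAt) (fun x hx => ?_) (Metric.mem_ball_self hδ)
    ((ContinuousMap.dist_apply_le_dist t).trans_lt hw)
  · exact key.trans (mul_le_mul_of_nonneg_left ((w - y).norm_coe_le_norm t) hε.le)
  -- The translate of `y` that passes through `x` at time t is within δ of `y`, so the sup-norm
  -- estimate for `g` can be read off at t.
  · have hd : dist (y + ContinuousMap.const I (x - y t)) y < δ := by
      rw [dist_eq_norm, add_sub_cancel_left]
      refine ((ContinuousMap.norm_le _ (norm_nonneg _)).2 fun _ => le_rfl).trans_lt ?_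
      change ‖x - y t‖ < δ
      rwa [← dist_eq_norm]
    have h1 : ‖g x - g (y t)‖ < ε / (‖B‖ + 1) := by
      simpa [dist_eq_norm] using (ContinuousMap.dist_apply_le_dist t).trans_lt (h hd)
    rw [← map_sub]
    refine (B.le_opNorm _).trans ?_
    rw [lt_div_iff₀ hB] at h1
    nlinarith [norm_nonneg (g x - g (y t))]

/-- The derivative of a postcomposition is `pathBilin` of another postcomposition, by `fderiv ℝ f`,
so induction applies. The target `F` must vary, since the next map has values in `E →L[ℝ] F`; hence
the common universe. -/
theorem contDiff_nat_comp_path (m : ℕ) : ∀ {F : Type u} [NormedAddCommGroup F] [NormedSpace ℝ F]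
    (f : C(E, F)), ContDiff ℝ m f → ContDiff ℝ m (fun y : C(I, E) => f.comp y) := by
  induction m with
  | zero =>
    intro F _ _ f _
    exact contDiff_zero.2 f.continuous_postcomp
  | succ m ih =>
    intro F _ _ f hf
    have h1 := contDiff_succ_iff_fderiv.1 (by exact_mod_cast hf : ContDiff ℝ ((m : WithTop ℕ∞) + 1) f)
    have hc : Continuous (fderiv ℝ f) := h1.2.2.continuous
    have := (contDiff_succ_iff_hasFDerivAt (n := m) (𝕜 := ℝ) (f := fun y : C(I, E) => f.comp y)).2
      ⟨_, (contDiff_pathBilin (ContinuousLinearMap.id ℝ (E →L[ℝ] F))).comp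
          (ih ⟨fderiv ℝ f, hc⟩ h1.2.2),
        hasFDerivAt_comp_path (ContinuousLinearMap.id ℝ (E →L[ℝ] F)) f ⟨fderiv ℝ f, hc⟩
          fun x => (h1.1 x).hasFDerivAt⟩
    exact_mod_cast this

/-- The superposition operator of a `C^k` map acts in a `C^k` way on continuous paths. -/
theorem contDiff_comp_path {k : ℕ∞} (f : C(E, F)) (hf : ContDiff ℝ k f) :
    ContDiff ℝ k (fun y : C(I, E) => f.comp y) :=
  contDiff_iff_forall_nat_le.2 fun m hm =>
    contDiff_nat_comp_path m f (hf.of_le (by exact_mod_cast hm))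

end Superposition

/-! ### The primitive as a bounded operator on paths -/

section Integration

open unitInterval MeasureTheory

variable {E : Type*} [NormedAddCommGroup E] [NormedSpace ℝ E]

theorem continuous_comp_projIcc {X : Type*} [TopologicalSpace X] (g : C(I, X)) :
    Continuous fun s : ℝ => g (projIcc 0 1 zero_le_one s) :=
  g.continuous.comp continuous_projIcc

variable {E : Type*} [NormedAddCommGroup E] [NormedSpace ℝ E]

/-- The operator taking a continuous path `g` to the path `t ↦ ∫ s in 0..t, g s`. -/
noncomputable def pathIntegral : C(I, E) →L[ℝ] C(I, E) :=
  LinearMap.mkContinuous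
    { toFun := fun g => ⟨fun t => ∫ s in (0 : ℝ)..t, g (projIcc 0 1 zero_le_one s),
        (intervalIntegral.continuous_primitive
          (fun _ _ => (continuous_comp_projIcc g).intervalIntegrable _ _) 0).comp
          continuous_subtype_val⟩
      map_add' := fun g₁ g₂ => by
        ext t
        exact intervalIntegral.integral_add ((continuous_comp_projIcc g₁).intervalIntegrable _ _)
          ((continuous_comp_projIcc g₂).intervalIntegrable _ _)
      map_smul' := fun c g => by
        ext t
        exact intervalIntegral.integral_smul c _ }
    1 (fun g => by
      rw [one_mul]
      refine (ContinuousMap.norm_le _ (norm_nonneg _)).2 fun t => ?_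
      refine (intervalIntegral.norm_integral_le_of_norm_le_const (C := ‖g‖)
        fun s _ => g.norm_coe_le_norm _).trans ?_
      rw [sub_zero, abs_of_nonneg t.2.1]
      exact mul_le_of_le_one_right (norm_nonneg _) t.2.2)

theorem pathIntegral_apply (g : C(I, E)) (t : I) :
    pathIntegral g t = ∫ s in (0 : ℝ)..t, g (projIcc 0 1 zero_le_one s) := rfl

@[simp]
theorem pathIntegral_zero_apply (g : C(I, E)) : pathIntegral g 0 = 0 := by
  simp [pathIntegral_apply]

/-- A path solving an integral equation, extended to the line, solves the differential equation. -/
theorem hasDerivWithinAt_of_eq_pathIntegral [CompleteSpace E] {y g : C(I, E)} {u : E} {c : ℝ}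
    (h : y = ContinuousMap.const I u + c • pathIntegral g) {t : ℝ} (ht : t ∈ Icc (0 : ℝ) 1) :
    HasDerivWithinAt (fun s => y (projIcc 0 1 zero_le_one s)) (c • g ⟨t, ht⟩)
      (Icc 0 1) t := by
  have hd : HasDerivAt (fun s : ℝ => u + c • ∫ r in (0 : ℝ)..s, g (projIcc 0 1 zero_le_one r))
      (c • g (projIcc 0 1 zero_le_one t)) t :=
    ((intervalIntegral.integral_hasDerivAt_right
      ((continuous_comp_projIcc g).intervalIntegrable _ _)
      (continuous_comp_projIcc g).aestronglyMeasurable.stronglyMeasurableAtFilter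
      (continuous_comp_projIcc g).continuousAt).const_smul c).const_add u
  rw [projIcc_of_mem zero_le_one ht] at hd
  have e : ∀ s ∈ Icc (0 : ℝ) 1, y (projIcc 0 1 zero_le_one s) =
      u + c • ∫ r in (0 : ℝ)..s, g (projIcc 0 1 zero_le_one r) := by
    intro s hs
    rw [projIcc_of_mem zero_le_one hs, h]
    simp [pathIntegral_apply]
  exact hd.hasDerivWithinAt.congr e (e t ht)

end Integration

/-! ### Smooth dependence of solutions of the integral equation, and the variational equation -/

section FlowPath

open unitInterval Topology

universe u

variable {E : Type u} [NormedAddCommGroup E] [NormedSpace ℝ E]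

/-- The constant path, as a function of its value. -/
noncomputable def pathConst : E →L[ℝ] C(I, E) :=
  LinearMap.mkContinuous
    { toFun := ContinuousMap.const I
      map_add' := fun _ _ => rfl
      map_smul' := fun _ _ => rfl } 1
    (fun x => by
      rw [one_mul]
      exact (ContinuousMap.norm_le _ (norm_nonneg _)).2 fun _ => le_rfl)

@[simp]
theorem pathConst_apply (x : E) (t : I) : pathConst x t = x := rfl

/-- The map `(h, y) ↦ (h, y - h ∫ f(y))`; its local inverse solves the integral equation of
`ẏ = h f(y)`. -/
noncomputable def picardDefect (f : C(E, E)) (p : ℝ × C(I, E)) : ℝ × C(I, E) :=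
  (p.1, p.2 - p.1 • pathIntegral (f.comp p.2))

theorem contDiff_picardDefect {k : ℕ∞} (f : C(E, E)) (hf : ContDiff ℝ k f) :
    ContDiff ℝ k (picardDefect f) := by
  have h1 : ContDiff ℝ k fun p : ℝ × C(I, E) => pathIntegral (f.comp p.2) :=
    (pathIntegral (E := E)).contDiff.comp ((contDiff_comp_path f hf).comp contDiff_snd)
  exact contDiff_fst.prodMk (contDiff_snd.sub (contDiff_fst.smul h1))

/-- The linear shear `(s, v) ↦ (s, v - s a)`. -/
noncomputable def shearEquiv {X : Type*} [NormedAddCommGroup X] [NormedSpace ℝ X] (a : X) :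
    (ℝ × X) ≃L[ℝ] (ℝ × X) :=
  ContinuousLinearEquiv.equivOfInverse
    ((ContinuousLinearMap.fst ℝ ℝ X).prod
      (ContinuousLinearMap.snd ℝ ℝ X - (ContinuousLinearMap.fst ℝ ℝ X).smulRight a))
    ((ContinuousLinearMap.fst ℝ ℝ X).prod
      (ContinuousLinearMap.snd ℝ ℝ X + (ContinuousLinearMap.fst ℝ ℝ X).smulRight a))
    (fun x => by ext <;> simp) (fun x => by ext <;> simp)

/-- At h = 0 the derivative of `f.comp y` in `y` is multiplied by zero. Only the derivative in the
factor h survives, which leaves an invertible shear. -/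
theorem hasFDerivAt_picardDefect_zero {k : ℕ∞} (hk : 1 ≤ k) (f : C(E, E)) (hf : ContDiff ℝ k f)
    (y : C(I, E)) :
    HasFDerivAt (picardDefect f)
      (shearEquiv (pathIntegral (f.comp y)) : (ℝ × C(I, E)) →L[ℝ] (ℝ × C(I, E))) (0, y) := by
  have h1 : ContDiff ℝ k fun p : ℝ × C(I, E) => pathIntegral (f.comp p.2) :=
    (pathIntegral (E := E)).contDiff.comp ((contDiff_comp_path f hf).comp contDiff_snd)
  have h2 := (h1.differentiable (by exact_mod_cast (zero_lt_one.trans_le hk).ne')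
    ((0 : ℝ), y)).hasFDerivAt
  have h3 := (hasFDerivAt_fst (𝕜 := ℝ) (p := ((0 : ℝ), y))).prodMk
    ((hasFDerivAt_snd (𝕜 := ℝ) (p := ((0 : ℝ), y))).sub
      ((hasFDerivAt_fst (𝕜 := ℝ) (p := ((0 : ℝ), y))).smul h2))
  refine h3.congr_fderiv ?_
  ext x <;> simp [shearEquiv, ContinuousLinearEquiv.equivOfInverse]

/-- Invert `picardDefect f` near (0, constant path z₀), a fixed point of it. The preimage of (h,
constant path z) is (h, y) with y the solution. -/
theorem exists_contDiffOn_integral_solution [CompleteSpace E] {k : ℕ∞} (hk : 1 ≤ k) (f : C(E, E))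
    (hf : ContDiff ℝ k f) (z₀ : E) :
    ∃ W : Set (ℝ × E), IsOpen W ∧ ((0 : ℝ), z₀) ∈ W ∧ ∃ Y : ℝ × E → C(I, E),
      ContDiffOn ℝ k Y W ∧
      ∀ p ∈ W, Y p = pathConst p.2 + p.1 • pathIntegral (f.comp (Y p)) := by
  have hk0 : (k : WithTop ℕ∞) ≠ 0 := by exact_mod_cast (zero_lt_one.trans_le hk).ne'
  have hG := contDiff_picardDefect f hf
  have hG' := hasFDerivAt_picardDefect_zero hk f hf (pathConst z₀)
  set e := hG.contDiffAt.toOpenPartialHomeomorph (picardDefect f) hG' hk0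
  have hecoe : ∀ x, e x = picardDefect f x := fun x => rfl
  have hmem : ((0 : ℝ), pathConst z₀) ∈ e.source :=
    hG.contDiffAt.mem_toOpenPartialHomeomorph_source hG' hk0
  -- The local inverse is C^k only where the derivative is invertible; `A` is the open set of such
  -- points.
  set A : Set (ℝ × C(I, E)) := {x | fderiv ℝ (picardDefect f) x ∈
    range ((↑) : ((ℝ × C(I, E)) ≃L[ℝ] (ℝ × C(I, E))) → _)}
  have hAo : IsOpen A :=
    ContinuousLinearEquiv.isOpen.preimage (hG.continuous_fderiv hk0)
  set j : ℝ × E →L[ℝ] ℝ × C(I, E) := (ContinuousLinearMap.id ℝ ℝ).prodMap pathConst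
  have hTo : IsOpen (e.target ∩ e.symm ⁻¹' A) := e.symm.isOpen_inter_preimage hAo
  have h0 : picardDefect f (0, pathConst z₀) = (0, pathConst z₀) := by simp [picardDefect]
  refine ⟨j ⁻¹' (e.target ∩ e.symm ⁻¹' A), hTo.preimage j.continuous, ?_,
    fun p => (e.symm (j p)).2, ?_, ?_⟩
  · have hj : j (0, z₀) = e (0, pathConst z₀) := by rw [hecoe, h0]; rfl
    rw [mem_preimage, hj]
    refine ⟨e.map_source hmem, ?_⟩
    rw [mem_preimage, e.left_inv hmem]
    exact ⟨_, hG'.fderiv.symm⟩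
  · intro p hp
    obtain ⟨e', he'⟩ := hp.2
    have hd : HasFDerivAt e (e' : (ℝ × C(I, E)) →L[ℝ] (ℝ × C(I, E))) (e.symm (j p)) := by
      rw [he']
      exact (hG.differentiable hk0 _).hasFDerivAt
    have hs := e.contDiffAt_symm hp.1 hd hG.contDiffAt
    exact (contDiffAt_snd.comp p (hs.comp p j.contDiff.contDiffAt)).contDiffWithinAt
  · intro p hp
    have h1 : picardDefect f (e.symm (j p)) = j p := e.right_inv hp.1
    have h2 : (e.symm (j p)).1 = p.1 := congrArg Prod.fst h1
    have h3 : (e.symm (j p)).2 - (e.symm (j p)).1 •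
        pathIntegral (f.comp (e.symm (j p)).2) = pathConst p.2 := congrArg Prod.snd h1
    rw [h2] at h3
    exact sub_eq_iff_eq_add.1 h3

/-- The variational equation preserves a bilinear form for which the linearised vector field is
infinitesimally skew. -/
theorem bilin_fderiv_integral_solution [CompleteSpace E] {f : C(E, E)} (hf : ContDiff ℝ 1 f)
    {B : E →L[ℝ] E →L[ℝ] ℝ}
    (hB : ∀ x a b, B (fderiv ℝ f x a) b + B a (fderiv ℝ f x b) = 0)
    {h : ℝ} {z : E} {Y : E → C(I, E)} (hY : DifferentiableAt ℝ Y z)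
    (heq : ∀ᶠ w in 𝓝 z, Y w = pathConst w + h • pathIntegral (f.comp (Y w))) (u v : E) :
    B (fderiv ℝ (fun w => Y w 1) z u) (fderiv ℝ (fun w => Y w 1) z v) = B u v := by
  have hc : Continuous (fderiv ℝ f) := hf.continuous_fderiv one_ne_zero
  set f' : C(E, E →L[ℝ] E) := ⟨fderiv ℝ f, hc⟩
  set Y' := fderiv ℝ Y z
  have hev : HasFDerivAt (fun y : C(I, E) => y 1) (ContinuousMap.evalCLM ℝ (1 : I)) (Y z) :=
    (ContinuousMap.evalCLM ℝ (1 : I) : C(I, E) →L[ℝ] E).hasFDerivAt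
  have h1 : fderiv ℝ (fun w => Y w 1) z = (ContinuousMap.evalCLM ℝ (1 : I)).comp Y' :=
    (hev.comp z hY.hasFDerivAt).fderiv
  have hN : HasFDerivAt (fun y : C(I, E) => f.comp y)
      (pathBilin (ContinuousLinearMap.id ℝ (E →L[ℝ] E)) (f'.comp (Y z))) (Y z) :=
    hasFDerivAt_comp_path (ContinuousLinearMap.id ℝ (E →L[ℝ] E)) f f'
      (fun x => (hf.differentiable one_ne_zero x).hasFDerivAt) (Y z)
  have h2 : HasFDerivAt Y ((pathConst : E →L[ℝ] C(I, E)) + h • (pathIntegral.comp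
      ((pathBilin (ContinuousLinearMap.id ℝ (E →L[ℝ] E)) (f'.comp (Y z))).comp Y'))) z :=
    HasFDerivAt.congr_of_eventuallyEq
      ((pathConst (E := E)).hasFDerivAt.add
      ((pathIntegral.hasFDerivAt.comp z (hN.comp z hY.hasFDerivAt)).const_smul h)) heq
  -- Differentiating the integral equation in the initial value gives the linearised equation for
  -- each variation `Y' a`.
  have h3 : ∀ a, Y' a = ContinuousMap.const I a + h • pathIntegral
      (pathBilin (ContinuousLinearMap.id ℝ (E →L[ℝ] E)) (f'.comp (Y z)) (Y' a)) := fun a =>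
    congrArg (fun L : E →L[ℝ] C(I, E) => L a) h2.fderiv
  -- By the product rule the derivative is h times the expression that `hB` makes zero.
  have h4 : ∀ t ∈ Icc (0 : ℝ) 1, HasDerivWithinAt
      (fun s => B (Y' u (projIcc 0 1 zero_le_one s)) (Y' v (projIcc 0 1 zero_le_one s)))
      0 (Icc 0 1) t := by
    intro t ht
    have := B.hasDerivWithinAt_of_bilinear (hasDerivWithinAt_of_eq_pathIntegral (h3 u) ht)
      (hasDerivWithinAt_of_eq_pathIntegral (h3 v) ht)
    refine this.congr_deriv ?_
    rw [projIcc_of_mem zero_le_one ht]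
    simp only [map_smul, smul_apply, ← smul_add]
    rw [add_comm]
    exact smul_eq_zero_of_right _ (hB _ _ _)
  have h5 := constant_of_derivWithin_zero (fun t ht => (h4 t ht).differentiableWithinAt)
    (fun t ht => (h4 t (Ico_subset_Icc_self ht)).derivWithin
      (uniqueDiffOn_Icc_zero_one t (Ico_subset_Icc_self ht))) 1 (right_mem_Icc.2 zero_le_one)
  have e0 : ∀ a, Y' a 0 = a := fun a => by rw [h3]; simp
  have p0 : projIcc (0 : ℝ) 1 zero_le_one 0 = 0 := projIcc_left _
  have p1 : projIcc (0 : ℝ) 1 zero_le_one 1 = 1 := projIcc_right _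
  simp only [p0, p1, e0] at h5
  rw [h1]
  exact h5

end FlowPath

/-! ### The flow map: uniqueness, smoothness, invariant bilinear forms -/

section Flow

open unitInterval

variable {n : ℕ}

/-- Both solutions stay in a common closed ball, on which the C¹ field is Lipschitz, so ODE
uniqueness applies. -/
theorem FlowsTo.unique {f : PhaseSpace n → PhaseSpace n} (hf : ContDiff ℝ 1 f) {h : ℝ}
    (hh : 0 ≤ h) {z a b : PhaseSpace n} (ha : FlowsTo f h z a) (hb : FlowsTo f h z b) : a = b := by
  obtain ⟨γ, hγ, hγ0, rfl⟩ := ha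
  obtain ⟨η, hη, hη0, rfl⟩ := hb
  have hb := ((isCompact_Icc.image_of_continuousOn hγ.continuousOn).union
    (isCompact_Icc.image_of_continuousOn hη.continuousOn)).isBounded
  obtain ⟨R, hR⟩ := hb.subset_closedBall 0
  obtain ⟨C, hC⟩ := hf.contDiffOn.exists_lipschitzOnWith one_ne_zero
    (convex_closedBall (0 : PhaseSpace n) R) (isCompact_closedBall 0 R)
  have hr : ∀ {α : ℝ → PhaseSpace n}, IsIntegralCurveOn α (fun _ => f) (Icc 0 h) →
      ∀ t ∈ Ico 0 h, HasDerivWithinAt α (f (α t)) (Ici t) t := fun hα t ht =>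
    (hα t (Ico_subset_Icc_self ht)).mono_of_mem_nhdsWithin (Icc_mem_nhdsGE_of_mem ht)
  exact ODE_solution_unique_of_mem_Icc_right (v := fun _ => f) (s := fun _ => Metric.closedBall 0 R)
    (fun _ _ => hC) hγ.continuousOn (hr hγ)
    (fun t ht => hR (Or.inl ⟨t, Ico_subset_Icc_self ht, rfl⟩)) hη.continuousOn (hr hη)
    (fun t ht => hR (Or.inr ⟨t, Ico_subset_Icc_self ht, rfl⟩)) (hγ0.trans hη0.symm)
    (right_mem_Icc.2 hh)

theorem FlowsTo.flowMap_eq {f : PhaseSpace n → PhaseSpace n} (hf : ContDiff ℝ 1 f) {h : ℝ}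
    (hh : 0 ≤ h) {z a : PhaseSpace n} (ha : FlowsTo f h z a) : flowMap f h z = a := by
  have hz : ∃ z', FlowsTo f h z z' := ⟨a, ha⟩
  rw [flowMap, dif_pos hz]
  exact hz.choose_spec.unique hf hh ha

/-- The path `y` solves ẏ = h f(y) on [0, 1]; the rescaled path s ↦ y(s/h) solves ẏ = f(y) on [0,
h]. -/
theorem flowsTo_of_integral_solution {f : C(PhaseSpace n, PhaseSpace n)} {h : ℝ} (hh : 0 < h)
    {z : PhaseSpace n} {y : C(I, PhaseSpace n)}
    (hy : y = pathConst z + h • pathIntegral (f.comp y)) : FlowsTo f h z (y 1) := by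
  refine ⟨fun s => y (projIcc 0 1 zero_le_one (h⁻¹ * s)), fun t ht => ?_, ?_, ?_⟩
  · have hmaps : MapsTo (fun s => h⁻¹ * s) (Icc 0 h) (Icc (0 : ℝ) 1) := fun s hs =>
      ⟨mul_nonneg (inv_nonneg.2 hh.le) hs.1, by
        rw [inv_mul_le_iff₀ hh, mul_one]; exact hs.2⟩
    have := (hasDerivWithinAt_of_eq_pathIntegral hy (hmaps ht)).scomp t
      (((hasDerivAt_id t).const_mul h⁻¹).hasDerivWithinAt) hmaps
    refine this.congr_deriv ?_
    rw [smul_smul, mul_one, inv_mul_cancel₀ hh.ne', one_smul]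
    exact congrArg (fun r => f (y r)) (projIcc_of_mem zero_le_one (hmaps ht)).symm
  · have p0 : projIcc (0 : ℝ) 1 zero_le_one 0 = 0 := projIcc_left _
    simp only [mul_zero, p0]
    rw [hy]
    simp
  · have p1 : projIcc (0 : ℝ) 1 zero_le_one 1 = 1 := projIcc_right _
    simp only [inv_mul_cancel₀ hh.ne', p1]

/-- Near `(0, z₀)` the flow of a `C^k` vector field is jointly `C^k` in time and initial value, and
it preserves every constant bilinear form preserved by the linearised vector field. -/
theorem exists_contDiffOn_flow {k : ℕ∞} (hk : 1 ≤ k) {f : PhaseSpace n → PhaseSpace n}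
    (hf : ContDiff ℝ k f) {B : PhaseSpace n →L[ℝ] PhaseSpace n →L[ℝ] ℝ}
    (hB : ∀ x a b, B (fderiv ℝ f x a) b + B a (fderiv ℝ f x b) = 0) (z₀ : PhaseSpace n) :
    ∃ W : Set (ℝ × PhaseSpace n), IsOpen W ∧ ((0 : ℝ), z₀) ∈ W ∧
      ∃ Φ : ℝ × PhaseSpace n → PhaseSpace n, ContDiffOn ℝ k Φ W ∧
        (∀ z, ((0 : ℝ), z) ∈ W → Φ (0, z) = z) ∧
        (∀ h z, (h, z) ∈ W → 0 < h → FlowsTo f h z (Φ (h, z))) ∧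
        ∀ h z, (h, z) ∈ W → ∀ u v,
          B (fderiv ℝ (fun w => Φ (h, w)) z u) (fderiv ℝ (fun w => Φ (h, w)) z v) = B u v := by
  have hk' : (1 : WithTop ℕ∞) ≤ k := by exact_mod_cast hk
  obtain ⟨W, hW, hz₀, Y, hY, heq⟩ := exists_contDiffOn_integral_solution hk ⟨f, hf.continuous⟩ hf z₀
  refine ⟨W, hW, hz₀, fun p => Y p 1, ?_, fun z hz => ?_, fun h z hz hh => ?_,
    fun h z hz u v => ?_⟩
  · exact (ContinuousMap.evalCLM ℝ (1 : I) : C(I, PhaseSpace n) →L[ℝ] _).contDiff.comp_contDiffOn hY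
  · simpa using congrArg (fun y : C(I, PhaseSpace n) => y 1) (heq _ hz)
  · exact flowsTo_of_integral_solution (f := ⟨f, hf.continuous⟩) hh (heq _ hz)
  · have hc : Continuous fun w : PhaseSpace n => (h, w) := by fun_prop
    have hYz : DifferentiableAt ℝ (fun w => Y (h, w)) z :=
      ((hY.differentiableOn (zero_lt_one.trans_le hk').ne').differentiableAt
        (hW.mem_nhds hz)).comp z (by fun_prop)
    exact bilin_fderiv_integral_solution (f := ⟨f, hf.continuous⟩) (hf.of_le hk') hB hYz
      (Filter.mem_of_superset ((hW.preimage hc).mem_nhds hz) fun w hw => heq _ hw) u v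

end Flow

/-! ### The symplectic form, Hamiltonian fields and the one-form α -/

section Symplectic

variable {n : ℕ}

/-- The standard symplectic form `ω(x, v) = ∑ j, (x_q^j v_p^j - x_p^j v_q^j)`. -/
noncomputable def symplecticForm (n : ℕ) : PhaseSpace n →L[ℝ] PhaseSpace n →L[ℝ] ℝ :=
  ∑ j : Fin n,
    ((EuclideanSpace.proj (Sum.inl j) : PhaseSpace n →L[ℝ] ℝ).smulRight
        (EuclideanSpace.proj (Sum.inr j) : PhaseSpace n →L[ℝ] ℝ) -
      (EuclideanSpace.proj (Sum.inr j) : PhaseSpace n →L[ℝ] ℝ).smulRight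
        (EuclideanSpace.proj (Sum.inl j) : PhaseSpace n →L[ℝ] ℝ))

theorem symplecticForm_apply (x v : PhaseSpace n) :
    symplecticForm n x v =
      ∑ j : Fin n, (x (Sum.inl j) * v (Sum.inr j) - x (Sum.inr j) * v (Sum.inl j)) := by
  simp [symplecticForm]

theorem symplecticForm_antisymm (x v : PhaseSpace n) :
    symplecticForm n x v = -symplecticForm n v x := by
  simp only [symplecticForm_apply, ← Finset.sum_neg_distrib]
  exact Finset.sum_congr rfl fun j _ => by ring

theorem symplecticForm_single_inr (x : PhaseSpace n) (j : Fin n) :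
    symplecticForm n x (EuclideanSpace.single (Sum.inr j) 1) = x (Sum.inl j) := by
  simp [symplecticForm_apply]

theorem symplecticForm_single_inl (x : PhaseSpace n) (j : Fin n) :
    symplecticForm n x (EuclideanSpace.single (Sum.inl j) 1) = -x (Sum.inr j) := by
  simp [symplecticForm_apply]

theorem symplecticForm_injective : Function.Injective (symplecticForm n) := by
  intro x y h
  ext (j | j)
  · rw [← symplecticForm_single_inr, h, symplecticForm_single_inr]
  · rw [← neg_inj, ← symplecticForm_single_inl, h, symplecticForm_single_inl]

theorem hamVF_inl (H : PhaseSpace n → ℝ) (z : PhaseSpace n) (j : Fin n) :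
    hamVF H z (Sum.inl j) = ∇ H z (Sum.inr j) := by
  rw [hamVF, Matrix.J_inv]
  simp [Matrix.J, Matrix.mulVec, dotProduct, Matrix.fromBlocks, Matrix.one_apply]

theorem hamVF_inr (H : PhaseSpace n → ℝ) (z : PhaseSpace n) (j : Fin n) :
    hamVF H z (Sum.inr j) = -∇ H z (Sum.inl j) := by
  rw [hamVF, Matrix.J_inv]
  simp [Matrix.J, Matrix.mulVec, dotProduct, Matrix.fromBlocks, Matrix.one_apply]

theorem symplecticForm_hamVF (H : PhaseSpace n → ℝ) (z : PhaseSpace n) :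
    symplecticForm n (hamVF H z) = fderiv ℝ H z := by
  ext v
  have h : fderiv ℝ H z v = inner ℝ (∇ H z) v := by
    simp [gradient]
  rw [h, symplecticForm_apply, PiLp.inner_apply, Fintype.sum_sum_type, ← Finset.sum_add_distrib]
  refine Finset.sum_congr rfl fun j _ => ?_
  simp [hamVF_inl, hamVF_inr]
  ring

theorem eq_hamVF_iff {H : PhaseSpace n → ℝ} {x z : PhaseSpace n} :
    x = hamVF H z ↔ symplecticForm n x = fderiv ℝ H z := by
  rw [← symplecticForm_hamVF, symplecticForm_injective.eq_iff]

theorem contDiff_hamVF {k : ℕ∞} {H : PhaseSpace n → ℝ}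
    (hH : ContDiff ℝ ((k + 1 : ℕ∞) : WithTop ℕ∞) H) : ContDiff ℝ k (hamVF H) := by
  have h := (contDiff_succ_iff_fderiv.1 (by exact_mod_cast hH :
    ContDiff ℝ ((k : WithTop ℕ∞) + 1) H)).2.2
  refine (contDiff_euclidean).2 fun i => ?_
  rcases i with j | j
  · simp_rw [← symplecticForm_single_inr, symplecticForm_hamVF]
    exact h.clm_apply contDiff_const
  · have e : ∀ x, hamVF H x (Sum.inr j) =
        -(fderiv ℝ H x (EuclideanSpace.single (Sum.inl j) 1)) := fun x => by
      rw [← symplecticForm_hamVF, symplecticForm_single_inl, neg_neg]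
    simp_rw [e]
    exact (h.clm_apply contDiff_const).neg

/-- Differentiating ω(J⁻¹∇H, ·) = dH turns this into the symmetry of the second derivative of `H`.
-/
theorem symplecticForm_fderiv_hamVF_skew {H : PhaseSpace n → ℝ} (hH : ContDiff ℝ 2 H)
    (x a b : PhaseSpace n) :
    symplecticForm n (fderiv ℝ (hamVF H) x a) b +
      symplecticForm n a (fderiv ℝ (hamVF H) x b) = 0 := by
  have hd : DifferentiableAt ℝ (hamVF H) x :=
    (contDiff_hamVF (k := 1) (by exact_mod_cast hH)).differentiable (by simp) x
  have h : fderiv ℝ (fderiv ℝ H) x = (symplecticForm n).comp (fderiv ℝ (hamVF H) x) := by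
    rw [← ((symplecticForm n).hasFDerivAt.comp x hd.hasFDerivAt).fderiv]
    congr 1
    ext1 z
    exact (symplecticForm_hamVF H z).symm
  have hs : IsSymmSndFDerivAt ℝ H x := hH.contDiffAt.isSymmSndFDerivAt (by simp)
  have h1 := hs a b
  rw [h] at h1
  rw [symplecticForm_antisymm a]
  exact add_neg_eq_zero.2 h1

theorem alphaForm_apply (x v : PhaseSpace n × PhaseSpace n) :
    alphaForm x v = symplecticForm n (x.2 - x.1) (midpt v.1 v.2) := by
  simp [alphaForm, dMid, midpt, symplecticForm_apply]
  simp only [← Finset.sum_sub_distrib]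
  exact Finset.sum_congr rfl fun _ _ => by ring

end Symplectic

/-! ### Generating functions and modified Hamiltonians in a given midpoint chart -/

section Chart

open Filter Topology

variable {n : ℕ} {k : ℕ∞} {φ : PhaseSpace n → PhaseSpace n} {U V : Set (PhaseSpace n)}

theorem eq_and_eq_of_midpt_eq_of_sub_eq {a b c d : PhaseSpace n} (hm : midpt a b = midpt c d)
    (hs : b - a = d - c) : a = c ∧ b = d := by
  have h1 : b + a = d + c := smul_right_injective _ (by norm_num : (1 / 2 : ℝ) ≠ 0) hm
  have ha : (2 : ℝ) • a = (2 : ℝ) • c := by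
    rw [two_smul, two_smul]
    calc a + a = (b + a) - (b - a) := by abel
      _ = (d + c) - (d - c) := by rw [h1, hs]
      _ = c + c := by abel
  have hac : a = c := smul_right_injective _ (two_ne_zero : (2 : ℝ) ≠ 0) ha
  subst hac
  exact ⟨rfl, sub_left_injective hs⟩

theorem HasFDerivAt.midpt {X : Type*} [NormedAddCommGroup X] [NormedSpace ℝ X]
    {f g : X → PhaseSpace n} {f' g' : X →L[ℝ] PhaseSpace n} {x : X}
    (hf : HasFDerivAt f f' x) (hg : HasFDerivAt g g' x) :
    HasFDerivAt (fun y => midpt (f y) (g y)) ((1 / 2 : ℝ) • (g' + f')) x :=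
  (hg.add hf).const_smul (1 / 2 : ℝ)

theorem hamVF_const_mul {H : PhaseSpace n → ℝ} {z : PhaseSpace n} (hH : DifferentiableAt ℝ H z)
    (c : ℝ) : hamVF (fun y => c * H y) z = c • hamVF H z :=
  Eq.symm <| eq_hamVF_iff.2 <| by
    rw [map_smul, symplecticForm_hamVF, fderiv_const_mul hH]

theorem satisfiesMidpointPDE_iff {S : PhaseSpace n → ℝ} :
    SatisfiesMidpointPDE φ U S ↔ ∀ z ∈ U, φ z - z = hamVF S (midpt z (φ z)) := by
  refine forall₂_congr fun z _ => ⟨fun h => ?_, fun h j => ?_⟩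
  · ext (j | j)
    · rw [hamVF_inl, PiLp.sub_apply, (h j).1, add_sub_cancel_left]
    · rw [hamVF_inr, PiLp.sub_apply, (h j).2, sub_sub_cancel_left]
  · have h1 := congrArg (fun x : PhaseSpace n => x (Sum.inl j)) h
    have h2 := congrArg (fun x : PhaseSpace n => x (Sum.inr j)) h
    simp only [hamVF_inl, hamVF_inr, PiLp.sub_apply] at h1 h2
    exact ⟨by linarith, by linarith⟩

theorem isMidpointStep_iff_sub_eq {f : PhaseSpace n → PhaseSpace n} {h : ℝ} {z z' : PhaseSpace n} :
    IsMidpointStep f h z z' ↔ z' - z = h • f (midpt z z') := by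
  rw [IsMidpointStep, sub_eq_iff_eq_add, add_comm]

namespace IsMidpointChart

theorem differentiableAt (hc : IsMidpointChart k φ U V) (hk : 1 ≤ k) {z : PhaseSpace n}
    (hz : z ∈ U) : DifferentiableAt ℝ φ z :=
  (hc.contDiffOn_map.differentiableOn
    (by exact_mod_cast (zero_lt_one.trans_le hk).ne')).differentiableAt
    (hc.isOpen_source.mem_nhds hz)

theorem hasFDerivAt_midpt (hc : IsMidpointChart k φ U V) (hk : 1 ≤ k) {z : PhaseSpace n}
    (hz : z ∈ U) : HasFDerivAt (fun w => midpt w (φ w))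
      ((1 / 2 : ℝ) • (fderiv ℝ φ z + ContinuousLinearMap.id ℝ (PhaseSpace n))) z :=
  (hasFDerivAt_id z).midpt (hc.differentiableAt hk hz).hasFDerivAt

/-- The last clause is the chain rule for m ∘ ψ = id: it exhibits a preimage of every vector under
Dm, which is what allows Dm to be cancelled. -/
theorem exists_hasFDerivAt_inverse (hc : IsMidpointChart k φ U V) (hk : 1 ≤ k) :
    ∃ ψ : PhaseSpace n → PhaseSpace n, ContDiffOn ℝ k ψ V ∧ MapsTo ψ V U ∧
      (∀ w ∈ V, midpt (ψ w) (φ (ψ w)) = w) ∧ (∀ z ∈ U, ψ (midpt z (φ z)) = z) ∧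
      ∀ w ∈ V, ∀ a, midpt (fderiv ℝ ψ w a) (fderiv ℝ φ (ψ w) (fderiv ℝ ψ w a)) = a := by
  obtain ⟨ψ, hinv, hψ⟩ := hc.contDiffOn_symm
  have hmaps : MapsTo ψ V U := fun w hw => by
    obtain ⟨z, hz, rfl⟩ := hc.bijOn.surjOn hw
    rw [hinv.1 hz]
    exact hz
  refine ⟨ψ, hψ, hmaps, hinv.2, hinv.1, fun w hw a => ?_⟩
  have hdψ : DifferentiableAt ℝ ψ w := (hψ.differentiableOn
    (by exact_mod_cast (zero_lt_one.trans_le hk).ne')).differentiableAt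
    (hc.isOpen_target.mem_nhds hw)
  have h1 := (hc.hasFDerivAt_midpt hk (hmaps hw)).comp w hdψ.hasFDerivAt
  have h2 := (hasFDerivAt_id (𝕜 := ℝ) w).congr_of_eventuallyEq
    (Filter.mem_of_superset (hc.isOpen_target.mem_nhds hw) fun x hx => hinv.2 hx)
  exact congrArg (fun L : PhaseSpace n →L[ℝ] PhaseSpace n => L a) (h1.unique h2)

theorem isMidpointGeneratingFunction_iff (hc : IsMidpointChart k φ U V) (hk : 1 ≤ k)
    {S : PhaseSpace n → ℝ} (hS : DifferentiableOn ℝ S V) :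
    IsMidpointGeneratingFunction φ U S ↔ SatisfiesMidpointPDE φ U S := by
  obtain ⟨ψ, -, -, hr, hl, hd⟩ := hc.exists_hasFDerivAt_inverse hk
  rw [satisfiesMidpointPDE_iff]
  refine forall₂_congr fun z hz => ?_
  have hmz : midpt z (φ z) ∈ V := hc.bijOn.mapsTo hz
  have hSz := (hS.differentiableAt (hc.isOpen_target.mem_nhds hmz)).hasFDerivAt.comp z
    (hc.hasFDerivAt_midpt hk hz)
  have hα : (alphaForm (z, φ z)).comp
      ((ContinuousLinearMap.id ℝ (PhaseSpace n)).prod (fderiv ℝ φ z)) =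
      (symplecticForm n (φ z - z)).comp
        ((1 / 2 : ℝ) • (fderiv ℝ φ z + ContinuousLinearMap.id ℝ (PhaseSpace n))) := by
    ext v
    exact alphaForm_apply _ _
  rw [eq_hamVF_iff, hα]
  refine ⟨fun h => ?_, fun h => ?_⟩
  · have e := h.unique hSz
    ext a
    have ha := hd _ hmz a
    rw [hl z hz] at ha
    set b := fderiv ℝ ψ (midpt z (φ z)) a
    have hb : symplecticForm n (φ z - z) (midpt b (fderiv ℝ φ z b)) =
        fderiv ℝ S (midpt z (φ z)) (midpt b (fderiv ℝ φ z b)) :=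
      congrArg (fun L : PhaseSpace n →L[ℝ] ℝ => L b) e
    rwa [ha] at hb
  · rw [h]
    exact hSz

theorem isInverseModifiedHamiltonian_iff (hc : IsMidpointChart k φ U V) {h : ℝ}
    {Hbar : PhaseSpace n → ℝ} (hH : DifferentiableOn ℝ Hbar V) :
    IsInverseModifiedHamiltonian φ h U Hbar ↔ SatisfiesMidpointPDE φ U (fun y => h * Hbar y) := by
  rw [satisfiesMidpointPDE_iff]
  refine forall₂_congr fun z hz => ?_
  rw [isMidpointStep_iff_sub_eq, hamVF_const_mul
    (hH.differentiableAt (hc.isOpen_target.mem_nhds (hc.bijOn.mapsTo hz)))]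

/-- The rule determines the difference z' - z from the midpoint. A midpoint in `V` is also that of
some pair (u, φ u) with `u ∈ U`, and two pairs with the same midpoint and difference are equal. -/
theorem isMidpointStep_iff (hc : IsMidpointChart k φ U V) {h : ℝ} {Hbar : PhaseSpace n → ℝ}
    (hH : IsInverseModifiedHamiltonian φ h U Hbar) {z z' : PhaseSpace n} (hm : midpt z z' ∈ V) :
    IsMidpointStep (hamVF Hbar) h z z' ↔ z ∈ U ∧ z' = φ z := by
  refine ⟨fun hs => ?_, ?_⟩
  · obtain ⟨u, hu, hum⟩ := hc.bijOn.surjOn hm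
    have hum : midpt u (φ u) = midpt z z' := hum
    have h1 := isMidpointStep_iff_sub_eq.1 (hH u hu)
    rw [hum, ← isMidpointStep_iff_sub_eq.1 hs] at h1
    obtain ⟨rfl, h2⟩ := eq_and_eq_of_midpt_eq_of_sub_eq hum h1
    exact ⟨hu, h2.symm⟩
  · rintro ⟨hz, rfl⟩
    exact hH z hz

/-- A symplectic map whose midpoint coordinates range over a convex set has a generating
function. -/
theorem exists_satisfiesMidpointPDE (hc : IsMidpointChart k φ U V) (hk : 1 ≤ k) (hV : Convex ℝ V)
    (hsymp : ∀ z ∈ U, ∀ u v, symplecticForm n (fderiv ℝ φ z u) (fderiv ℝ φ z v) =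
      symplecticForm n u v) :
    ∃ S : PhaseSpace n → ℝ, ContDiffOn ℝ ((k + 1 : ℕ∞) : WithTop ℕ∞) S V ∧
      SatisfiesMidpointPDE φ U S := by
  obtain ⟨ψ, hψ, hmaps, hr, hl, hd⟩ := hc.exists_hasFDerivAt_inverse hk
  have hk0 : (k : WithTop ℕ∞) ≠ 0 := by exact_mod_cast (zero_lt_one.trans_le hk).ne'
  set η : PhaseSpace n → PhaseSpace n →L[ℝ] ℝ := fun w =>
    symplecticForm n (φ (ψ w) - ψ w) with hη
  have hηk : ContDiffOn ℝ k η V :=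
    (symplecticForm n).contDiff.comp_contDiffOn ((hc.contDiffOn_map.comp hψ hmaps).sub hψ)
  obtain ⟨S, hS⟩ := hV.exists_forall_hasFDerivAt_of_fderiv_symmetric hc.isOpen_target
    (hηk.differentiableOn hk0) (fun w hw a b => by
      have hdψ := ((hψ.differentiableOn hk0).differentiableAt
        (hc.isOpen_target.mem_nhds hw)).hasFDerivAt
      have hdφ := (hc.differentiableAt hk (hmaps hw)).hasFDerivAt
      have hdη : HasFDerivAt η ((symplecticForm n).comp
          ((fderiv ℝ φ (ψ w)).comp (fderiv ℝ ψ w) - fderiv ℝ ψ w)) w :=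
        (symplecticForm n).hasFDerivAt.comp w ((hdφ.comp w hdψ).sub hdψ)
      rw [hdη.fderiv]
      simp only [ContinuousLinearMap.comp_apply, sub_apply]
      have ha := hd w hw a
      have hb := hd w hw b
      have h1 := hsymp _ (hmaps hw) (fderiv ℝ ψ w a) (fderiv ℝ ψ w b)
      set D := fderiv ℝ φ (ψ w)
      set u := fderiv ℝ ψ w a
      set v := fderiv ℝ ψ w b
      -- With a = (Du + u)/2 and b = (Dv + v)/2, the antisymmetric part Dη(a)b - Dη(b)a equals ω(Du,
      -- Dv) - ω(u, v), which vanishes by `h1`.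
      rw [← ha, ← hb]
      have h2 := symplecticForm_antisymm (D u) (D v)
      have h3 := symplecticForm_antisymm u v
      have h4 := symplecticForm_antisymm (D u) v
      have h5 := symplecticForm_antisymm u (D v)
      simp only [midpt, map_sub, map_add, map_smul, sub_apply, smul_eq_mul]
      linarith)
  refine ⟨S, ?_, satisfiesMidpointPDE_iff.2 fun z hz => ?_⟩
  · push_cast
    refine (contDiffOn_succ_iff_fderiv_of_isOpen hc.isOpen_target).2
      ⟨fun w hw => (hS w hw).differentiableAt.differentiableWithinAt, by simp, ?_⟩
    -- One derivative is gained over φ, since the derivative of `S` is the C^k form `η`.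
    exact hηk.congr fun w hw => (hS w hw).fderiv
  · rw [eq_hamVF_iff, (hS _ (hc.bijOn.mapsTo hz)).fderiv, hη]
    simp only [hl z hz]

end IsMidpointChart

end Chart

/-! ### Existence of charts for small step sizes -/

section Existence

open Filter Topology

variable {n : ℕ} {k : ℕ∞}

/-- Where the derivative of the midpoint map is invertible, midpoint coordinates are locally a
chart of the graph, with convex image. -/
theorem exists_isMidpointChart (hk : 1 ≤ k) {φ : PhaseSpace n → PhaseSpace n}
    {O : Set (PhaseSpace n)} (hO : IsOpen O) (hφ : ContDiffOn ℝ k φ O)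
    (hinv : ∀ z ∈ O, (1 / 2 : ℝ) • (fderiv ℝ φ z + ContinuousLinearMap.id ℝ (PhaseSpace n)) ∈
      range ((↑) : (PhaseSpace n ≃L[ℝ] PhaseSpace n) → _)) {z : PhaseSpace n} (hz : z ∈ O) :
    ∃ U V : Set (PhaseSpace n), z ∈ U ∧ U ⊆ O ∧ IsMidpointChart k φ U V ∧ Convex ℝ V := by
  have hk0 : (k : WithTop ℕ∞) ≠ 0 := by exact_mod_cast (zero_lt_one.trans_le hk).ne'
  set m : PhaseSpace n → PhaseSpace n := fun w => midpt w (φ w)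
  have hmk : ∀ w ∈ O, ContDiffAt ℝ k m w := fun w hw =>
    ((hφ.contDiffAt (hO.mem_nhds hw)).add contDiffAt_id).const_smul (1 / 2 : ℝ)
  have hmd : ∀ w ∈ O, ∃ e' : PhaseSpace n ≃L[ℝ] PhaseSpace n,
      HasFDerivAt m (e' : PhaseSpace n →L[ℝ] PhaseSpace n) w := fun w hw => by
    obtain ⟨e', he'⟩ := hinv w hw
    refine ⟨e', ?_⟩
    rw [he']
    exact (hasFDerivAt_id w).midpt
      ((hφ.contDiffAt (hO.mem_nhds hw)).differentiableAt hk0).hasFDerivAt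
  obtain ⟨e', he'⟩ := hmd z hz
  obtain ⟨e, hem, hzs, hsO⟩ : ∃ e : OpenPartialHomeomorph (PhaseSpace n) (PhaseSpace n),
      (e : PhaseSpace n → PhaseSpace n) = m ∧ z ∈ e.source ∧ e.source ⊆ O :=
    ⟨((hmk z hz).toOpenPartialHomeomorph m he' hk0).restrOpen O hO, rfl,
      ⟨(hmk z hz).mem_toOpenPartialHomeomorph_source he' hk0, hz⟩, fun w hw => hw.2⟩
  -- Shrinking the target to a ball makes `V` convex, as the Poincaré lemma requires.
  obtain ⟨r, hr, hball⟩ := Metric.isOpen_iff.1 e.open_target _ (e.map_source hzs)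
  have hbij : BijOn e (e.source ∩ e ⁻¹' Metric.ball (e z) r) (Metric.ball (e z) r) :=
    ⟨fun w hw => hw.2, e.injOn.mono inter_subset_left, fun w hw =>
      ⟨e.symm w, ⟨e.map_target (hball hw), by
        rw [mem_preimage, e.right_inv (hball hw)]; exact hw⟩, e.right_inv (hball hw)⟩⟩
  have hinvOn : InvOn e.symm e (e.source ∩ e ⁻¹' Metric.ball (e z) r) (Metric.ball (e z) r) :=
    ⟨fun w hw => e.left_inv hw.1, fun w hw => e.right_inv (hball hw)⟩
  have hsymm : ContDiffOn ℝ k e.symm (Metric.ball (e z) r) := fun w hw => by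
    have hwO := hsO (e.map_target (hball hw))
    obtain ⟨d, hd⟩ := hmd _ hwO
    have hk' := hmk _ hwO
    rw [← hem] at hd hk'
    exact (e.contDiffAt_symm (hball hw) hd hk').contDiffWithinAt
  have hUo := e.isOpen_inter_preimage (Metric.isOpen_ball (x := e z) (ε := r))
  have hzU : z ∈ e.source ∩ e ⁻¹' Metric.ball (e z) r := 
    ⟨hzs, mem_preimage.2 (Metric.mem_ball_self hr)⟩
  have hUO : e.source ∩ e ⁻¹' Metric.ball (e z) r ⊆ O := fun w hw => hsO hw.1
  -- The two sets mention `e`; they are made opaque so that rewriting by `hem` affects only the map.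
  generalize e.source ∩ e ⁻¹' Metric.ball (e z) r = U at *
  have hball' : IsOpen (Metric.ball (e z) r) ∧ Convex ℝ (Metric.ball (e z) r) :=
    ⟨Metric.isOpen_ball, convex_ball _ _⟩
  generalize Metric.ball (e z) r = V at *
  rw [hem] at hbij hinvOn
  exact ⟨U, V, hzU, hUO, ⟨hUo, hball'.1, hφ.mono hUO, hbij,
    e.symm, hinvOn, hsymm⟩, hball'.2⟩

/-- Invertibility of (DΦ + I)/2, with D the derivative in z, is an open condition on (h, z) that
holds at (0, z₀). A product neighbourhood inside that open set yields one step-size bound for all z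
near z₀. -/
theorem exists_symplectic_midpointChart_near (hk : 1 ≤ k) {H : PhaseSpace n → ℝ}
    (hH : ContDiff ℝ ((k + 1 : ℕ∞) : WithTop ℕ∞) H) (z₀ : PhaseSpace n) :
    ∃ A ∈ 𝓝 z₀, ∃ h₀ : ℝ, 0 < h₀ ∧ ∀ h : ℝ, 0 < h → h < h₀ → ∀ z ∈ A,
      ∃ U V : Set (PhaseSpace n), z ∈ U ∧ FlowDefinedOn (hamVF H) h U ∧
        IsMidpointChart k (flowMap (hamVF H) h) U V ∧ Convex ℝ V ∧
        ∀ z ∈ U, ∀ u v, symplecticForm n (fderiv ℝ (flowMap (hamVF H) h) z u)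
          (fderiv ℝ (flowMap (hamVF H) h) z v) = symplecticForm n u v := by
  have hk1 : (1 : WithTop ℕ∞) ≤ k := by exact_mod_cast hk
  have hk0 : (k : WithTop ℕ∞) ≠ 0 := (zero_lt_one.trans_le hk1).ne'
  have hf := contDiff_hamVF hH
  have hf1 : ContDiff ℝ 1 (hamVF H) := hf.of_le hk1
  have hH2 : ContDiff ℝ 2 H := hH.of_le (by
    have : (1 + 1 : ℕ∞) ≤ k + 1 := by gcongr
    rw [one_add_one_eq_two] at this
    exact WithTop.coe_le_coe.2 this)
  obtain ⟨W, hW, hz₀, Φ, hΦ, hΦ0, hflow, hsymp⟩ :=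
    exists_contDiffOn_flow hk hf (symplecticForm_fderiv_hamVF_skew hH2) z₀
  set L : ℝ × PhaseSpace n → PhaseSpace n →L[ℝ] PhaseSpace n := fun p =>
    (1 / 2 : ℝ) • ((fderiv ℝ Φ p).comp (ContinuousLinearMap.inr ℝ ℝ (PhaseSpace n)) +
      ContinuousLinearMap.id ℝ (PhaseSpace n)) with hL
  have hLc : ContinuousOn L W := by
    have h1 : ContinuousOn (fun p => (fderiv ℝ Φ p).comp
        (ContinuousLinearMap.inr ℝ ℝ (PhaseSpace n)) +
        ContinuousLinearMap.id ℝ (PhaseSpace n)) W :=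
      ((hΦ.continuousOn_fderiv_of_isOpen hW hk1).clm_comp continuousOn_const).add
        continuousOn_const
    exact h1.const_smul (1 / 2 : ℝ)
  have hslice : ∀ h z, (h, z) ∈ W → HasFDerivAt (fun w => Φ (h, w))
      ((fderiv ℝ Φ (h, z)).comp (ContinuousLinearMap.inr ℝ ℝ (PhaseSpace n))) z := fun h z hz =>
    ((hΦ.contDiffAt (hW.mem_nhds hz)).differentiableAt hk0).hasFDerivAt.comp z
      (hasFDerivAt_prodMk_right h z)
  set W' := W ∩ L ⁻¹' range ((↑) : (PhaseSpace n ≃L[ℝ] PhaseSpace n) → _)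
  have hW'o : IsOpen W' := hLc.isOpen_inter_preimage hW ContinuousLinearEquiv.isOpen
  have hc : ∀ h : ℝ, Continuous fun w : PhaseSpace n => (h, w) := fun h => by fun_prop
  have hz₀' : ((0 : ℝ), z₀) ∈ W' := by
    refine ⟨hz₀, ContinuousLinearEquiv.refl ℝ (PhaseSpace n), ?_⟩
    -- At time zero the flow is the identity near z₀, so the operator is (I + I)/2 = I.
    have h1 := (hasFDerivAt_id (𝕜 := ℝ) z₀).congr_of_eventuallyEq
      (Filter.mem_of_superset ((hW.preimage (hc 0)).mem_nhds hz₀) fun w hw => hΦ0 w hw)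
    rw [hL]
    simp only
    rw [(hslice 0 z₀ hz₀).unique h1]
    ext1 v
    simp [← two_smul ℝ]
  obtain ⟨T, hT, A, hA, hTA⟩ := mem_nhds_prod_iff.1 (hW'o.mem_nhds hz₀')
  obtain ⟨ε, hε, hεT⟩ := Metric.mem_nhds_iff.1 hT
  refine ⟨A, hA, ε, hε, fun h hh hhε z hz => ?_⟩
  have hhT : h ∈ T := hεT (by simpa [abs_of_pos hh] using hhε)
  set O : Set (PhaseSpace n) := {w | (h, w) ∈ W'}
  have hO : IsOpen O := hW'o.preimage (hc h)
  have heq : ∀ w ∈ O, flowMap (hamVF H) h w = Φ (h, w) := fun w hw =>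
    (hflow h w hw.1 hh).flowMap_eq hf1 hh.le
  have hfd : ∀ w ∈ O, fderiv ℝ (flowMap (hamVF H) h) w = fderiv ℝ (fun w => Φ (h, w)) w :=
    fun w hw => Filter.EventuallyEq.fderiv_eq
      (Filter.mem_of_superset (hO.mem_nhds hw) heq)
  have hφ : ContDiffOn ℝ k (flowMap (hamVF H) h) O :=
    (hΦ.comp (contDiff_prodMk_right h).contDiffOn fun w (hw : w ∈ O) => hw.1).congr heq
  obtain ⟨U, V, hzU, hUO, hchart, hV⟩ := exists_isMidpointChart hk hO hφ
    (fun w hw => by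
      rw [hfd w hw, (hslice h w hw.1).fderiv]
      exact hw.2) (hTA (mk_mem_prod hhT hz) : z ∈ O)
  refine ⟨U, V, hzU, fun w hw w' => ⟨fun hw' => (hw'.flowMap_eq hf1 hh.le).symm, ?_⟩, hchart, hV,
    fun w hw u v => ?_⟩
  · rintro rfl
    rw [heq w (hUO hw)]
    exact hflow h w (hUO hw).1 hh
  · rw [hfd w (hUO hw)]
    exact hsymp h w (hUO hw).1 u v

/-- Compactness induction: the bound passes to subsets, and a union of two sets takes the minimum of
their bounds. -/
theorem exists_symplectic_midpointChart (hk : 1 ≤ k) {H : PhaseSpace n → ℝ}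
    (hH : ContDiff ℝ ((k + 1 : ℕ∞) : WithTop ℕ∞) H) {K : Set (PhaseSpace n)} (hK : IsCompact K) :
    ∃ h₀ : ℝ, 0 < h₀ ∧ ∀ h : ℝ, 0 < h → h < h₀ → ∀ z ∈ K,
      ∃ U V : Set (PhaseSpace n), z ∈ U ∧ FlowDefinedOn (hamVF H) h U ∧
        IsMidpointChart k (flowMap (hamVF H) h) U V ∧ Convex ℝ V ∧
        ∀ z ∈ U, ∀ u v, symplecticForm n (fderiv ℝ (flowMap (hamVF H) h) z u)
          (fderiv ℝ (flowMap (hamVF H) h) z v) = symplecticForm n u v := by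
  refine hK.induction_on ⟨1, one_pos, fun _ _ _ _ hz => hz.elim⟩ ?_ ?_ fun z₀ _ => ?_
  · rintro s t hst ⟨h₀, hpos, ht⟩
    exact ⟨h₀, hpos, fun h hh hlt z hz => ht h hh hlt z (hst hz)⟩
  · rintro s t ⟨h₁, hpos₁, hs⟩ ⟨h₂, hpos₂, ht⟩
    refine ⟨min h₁ h₂, lt_min hpos₁ hpos₂, fun h hh hlt z hz => hz.elim ?_ ?_⟩
    · exact hs h hh (hlt.trans_le (min_le_left _ _)) z
    · exact ht h hh (hlt.trans_le (min_le_right _ _)) z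
  · obtain ⟨A, hA, hex⟩ := exists_symplectic_midpointChart_near hk hH z₀
    exact ⟨A, mem_nhdsWithin_of_mem_nhds hA, hex⟩

end Existence

theorem mainTheorem1 (n : ℕ) (k : ℕ∞) (hk : 1 ≤ k) (H : PhaseSpace n → ℝ)
    (hH : ContDiff ℝ ((k + 1 : ℕ∞) : WithTop ℕ∞) H)
    (K : Set (PhaseSpace n)) (hK : IsCompact K) :
    ∃ h₀ : ℝ, 0 < h₀ ∧ ∀ h : ℝ, 0 < h → h < h₀ → ∀ z₀ ∈ K,
      ∃ U V : Set (PhaseSpace n), z₀ ∈ U ∧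
        -- the exact flow map exists near `z₀`, and midpoint coordinates are a chart of its graph
        FlowDefinedOn (hamVF H) h U ∧
        IsMidpointChart k (flowMap (hamVF H) h) U V ∧
        -- a generating function exists
        (∃ S : PhaseSpace n → ℝ, ContDiffOn ℝ ((k + 1 : ℕ∞) : WithTop ℕ∞) S V ∧
          IsMidpointGeneratingFunction (flowMap (hamVF H) h) U S) ∧
        -- generating functions are the solutions of the partial differential equations
        (∀ S : PhaseSpace n → ℝ, DifferentiableOn ℝ S V →
          (IsMidpointGeneratingFunction (flowMap (hamVF H) h) U S ↔
            SatisfiesMidpointPDE (flowMap (hamVF H) h) U S)) ∧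
        -- `Hbar` is an inverse modified Hamiltonian iff `h * Hbar` solves the same equations;
        -- the midpoint rule applied to it is then the exact flow, and nothing else
        (∀ Hbar : PhaseSpace n → ℝ, DifferentiableOn ℝ Hbar V →
          (IsInverseModifiedHamiltonian (flowMap (hamVF H) h) h U Hbar ↔
            SatisfiesMidpointPDE (flowMap (hamVF H) h) U (fun y => h * Hbar y)) ∧
          (IsInverseModifiedHamiltonian (flowMap (hamVF H) h) h U Hbar →
            ∀ z z' : PhaseSpace n, midpt z z' ∈ V →
              (IsMidpointStep (hamVF Hbar) h z z' ↔ z ∈ U ∧ z' = flowMap (hamVF H) h z))) ∧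
        -- an inverse modified Hamiltonian exists
        (∃ Hbar : PhaseSpace n → ℝ, ContDiffOn ℝ ((k + 1 : ℕ∞) : WithTop ℕ∞) Hbar V ∧
          IsInverseModifiedHamiltonian (flowMap (hamVF H) h) h U Hbar) := by
  obtain ⟨h₀, hpos, hex⟩ := exists_symplectic_midpointChart hk hH hK
  refine ⟨h₀, hpos, fun h hh hlt z₀ hz₀ => ?_⟩
  obtain ⟨U, V, hzU, hflow, hchart, hV, hsymp⟩ := hex h hh hlt z₀ hz₀
  obtain ⟨S, hSk, hS⟩ := hchart.exists_satisfiesMidpointPDE hk hV hsymp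
  have hSd : DifferentiableOn ℝ S V := hSk.differentiableOn (by simp)
  -- The inverse modified Hamiltonian is S/h.
  have hHk : ContDiffOn ℝ ((k + 1 : ℕ∞) : WithTop ℕ∞) (fun y => h⁻¹ * S y) V :=
    contDiffOn_const.mul hSk
  refine ⟨U, V, hzU, hflow, hchart,
    ⟨S, hSk, (hchart.isMidpointGeneratingFunction_iff hk hSd).2 hS⟩,
    fun S' hS' => hchart.isMidpointGeneratingFunction_iff hk hS',
    fun Hbar hHbar => ⟨hchart.isInverseModifiedHamiltonian_iff hHbar,
      fun hinv z z' hm => hchart.isMidpointStep_iff hinv hm⟩,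
    fun y => h⁻¹ * S y, hHk, ?_⟩
  rw [hchart.isInverseModifiedHamiltonian_iff (hHk.differentiableOn (by simp))]
  simpa only [mul_inv_cancel_left₀ hh.ne'] using hS
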